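/- Let $n\ge 2$ and let $K$ be a field of characteristic $0$ (for instance $\mathbb{R}$). Let $O_n=K(2n-1,n-1)$ be the odd graph, that is, the Kneser graph whose vertices are the $(n-1)$-element subsets of $\{1,\dots,2n-1\}$, two vertices being adjacent if and only if they are disjoint, and let $B(O_n)$ be its adjacency matrix, regarded as a matrix over $K$. Let $(E_{m,k})_{m,k\ge 0}$ be the Catalan triangle, defined by $E_{0,0}=1$, $E_{0,k}=0$ for $k\ge 1$, and $$E_{m,k}=E_{m-1,k-1}+2E_{m-1,k}+E_{m-1,k+1}\qquad (m\ge 1,\ k\ge 0),$$ where $E_{m-1,-1}=0$. Then the eigenvalues of $B(O_n)$ in $K$ are exactly the pairwise distinct numbers $$\lambda_i=(-1)^{n+i}\,i,\qquad i=1,\dots,n,$$ and for each $i=1,\dots,n$ the multiplicity of $\lambda_i$, both geometric (the dimension of $\ker(B(O_n)-\lambda_i I)$ over $K$) and algebraic (as a root of the characteristic polynomial), is $E_{n-1,i-1}$. In particular, the eigenvalue $\lambda_1=(-1)^{n+1}$ has geometric and algebraic multiplicity $C_n=\frac{1}{n+1}\binom{2n}{n}$, the $n$th Catalan number. -/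

import Mathlib

/-- The Kneser graph `K(r, s)`: the vertices are the `s`-element subsets of an `r`-element set, and
two distinct vertices are adjacent when they are disjoint. (Distinctness matters only for `s = 0`,
because a nonempty set is never disjoint from itself.) -/
def kneserGraph (r s : ℕ) : SimpleGraph {A : Finset (Fin r) // A.card = s} where
  Adj A B := A ≠ B ∧ Disjoint A.1 B.1
  symm := ⟨fun _ _ h => ⟨h.1.symm, h.2.symm⟩⟩
  loopless := ⟨fun _ h => h.1 rfl⟩

instance kneserGraph.instDecidableRelAdj (r s : ℕ) : DecidableRel (kneserGraph r s).Adj :=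
  fun A B => inferInstanceAs (Decidable (A ≠ B ∧ Disjoint A.1 B.1))

/-- The odd graph `O_n = K(2n - 1, n - 1)`, meant for `n ≥ 2`. -/
abbrev oddGraph (n : ℕ) : SimpleGraph {A : Finset (Fin (2 * n - 1)) // A.card = n - 1} :=
  kneserGraph (2 * n - 1) (n - 1)

/-- The entry `E_{n,k}` of the Catalan triangle: `E_{0,0} = 1`, `E_{0,k} = 0` for `k > 0`, and
`E_{n,k} = E_{n-1,k-1} + 2 E_{n-1,k} + E_{n-1,k+1}` for `n ≥ 1`, where `E_{n-1,-1} = 0`. -/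
def catalanTriangle : ℕ → ℕ → ℕ
  | 0, 0 => 1
  | 0, _ + 1 => 0
  | n + 1, 0 => 2 * catalanTriangle n 0 + catalanTriangle n 1
  | n + 1, k + 1 =>
      catalanTriangle n k + 2 * catalanTriangle n (k + 1) + catalanTriangle n (k + 2)

/-- The Catalan triangle is lower triangular. -/
theorem catalanTriangle_eq_zero_of_lt : ∀ {n k : ℕ}, n < k → catalanTriangle n k = 0
  | 0, 0, h => absurd h (lt_irrefl 0)
  | 0, _ + 1, _ => rfl
  | _ + 1, 0, h => absurd h (Nat.not_lt_zero _)
  | n + 1, k + 1, h => by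
      rw [catalanTriangle, catalanTriangle_eq_zero_of_lt (show n < k by omega),
        catalanTriangle_eq_zero_of_lt (show n < k + 1 by omega),
        catalanTriangle_eq_zero_of_lt (show n < k + 2 by omega)]

/-- The adjacency operator of the odd graph `O_n`: the linear map on functions on the vertices
given by the adjacency matrix over `K`. -/
noncomputable abbrev oddAdjacency (K : Type*) [Field K] (n : ℕ) :
    Module.End K ({A : Finset (Fin (2 * n - 1)) // A.card = n - 1} → K) :=
  Matrix.toLin' ((oddGraph n).adjMatrix K)

/-! Put `k = n - 1`, `N = 2k + 1`, and let `e_T` be the indicator of the `k`-sets containing `T`.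
The spans `W_j` of the `e_T` with `|T| = j - 1` form a flag from `0` to the whole space. For `A`
disjoint from `T`, exactly `k + 1 - |T|` neighbours of `A` contain `T`; otherwise none do. By
inclusion-exclusion the adjacency operator sends `e_T` to `(k + 1 - |T|) ∑_{S ⊆ T} (-1)^|S| e_S`. It
is thus triangular, with scalar `(-1)^j (k + 1 - j)` on `W_{j+1} / W_j`. These scalars are distinct,
so both multiplicities equal `dim W_{j+1} - dim W_j`. The `e_T` of each level are independent, which
makes this a difference of consecutive binomials, and that is a Catalan triangle entry. -/

/-! ### Injectivity of inclusion sums -/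

-- Double counting with `B = A.erase a`: for `a ∈ A`, `T ⊆ A` iff `T.erase a ⊆ B`.
open Finset in
theorem sum_card_succ_superset_sum_erase {α K : Type*} [Fintype α] [DecidableEq α] [Field K]
    (f : Finset α → K) (r : ℕ) (T : Finset α) :
    ∑ A ∈ powersetCard (r + 1) univ with T ⊆ A, ∑ a ∈ A, f (A.erase a) =
      ∑ B ∈ powersetCard r univ, ∑ a ∈ Bᶜ, if T.erase a ⊆ B then f B else 0 := by
  simp_rw [← Finset.sum_filter]
  rw [Finset.sum_sigma', Finset.sum_sigma']
  refine Finset.sum_bij' (fun p _ => ⟨p.1.erase p.2, p.2⟩) (fun p _ => ⟨insert p.2 p.1, p.2⟩)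
    ?_ ?_ ?_ ?_ ?_
  · rintro ⟨A, a⟩ h
    simp only [mem_sigma, mem_filter, mem_powersetCard, subset_univ, true_and, mem_compl] at h ⊢
    refine ⟨by rw [card_erase_of_mem h.2, h.1.1]; rfl, by simp, erase_subset_erase _ h.1.2⟩
  · rintro ⟨B, a⟩ h
    simp only [mem_sigma, mem_filter, mem_powersetCard, subset_univ, true_and, mem_compl] at h ⊢
    refine ⟨⟨by rw [card_insert_of_notMem h.2.1, h.1], ?_⟩, by simp⟩
    rw [subset_insert_iff]; exact h.2.2
  · rintro ⟨A, a⟩ h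
    simp only [mem_sigma] at h
    simp [insert_erase h.2]
  · rintro ⟨B, a⟩ h
    simp only [mem_sigma, mem_filter, mem_compl] at h
    simp [erase_insert h.2.1]
  · rintro ⟨A, a⟩ h
    rfl

open Finset in
theorem sum_compl_erase_subset {α K : Type*} [Fintype α] [DecidableEq α] [Field K]
    (B T : Finset α) :
    (∑ a ∈ Bᶜ, if T.erase a ⊆ B then (1 : K) else 0) =
      ((Fintype.card α : K) - B.card - T.card) * (if T ⊆ B then 1 else 0) +
        ∑ t ∈ T, if T.erase t ⊆ B then (1 : K) else 0 := by
  by_cases h : T ⊆ B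
  · have h' : ∀ a, T.erase a ⊆ B := fun a => (erase_subset _ _).trans h
    simp only [h', h, if_true, sum_const, card_compl, nsmul_eq_mul, mul_one]
    rw [Nat.cast_sub (card_le_univ B)]
    ring
  · rw [if_neg h, mul_zero, zero_add, ← sum_filter, ← sum_filter]
    congr 1
    ext a
    simp only [mem_filter, mem_compl, and_congr_left_iff]
    intro ha
    constructor
    · intro haB
      by_contra haT
      rw [erase_eq_of_notMem haT] at ha
      exact h ha
    · intro haT haB
      apply h
      rw [← insert_erase haT]
      exact insert_subset haB ha

-- Let `F T` be the sum of `f` over the `r`-sets containing `T`. Summing the hypothesis over all `A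
-- ⊇ T` gives `(N - r - |T|) F T + ∑ t ∈ T, F (T.erase t) = 0` with `N = Fintype.card α`. As `r +
-- |T| ≤ 2r < N`, induction on `T` kills every `F T`, and `F B = f B` when `|B| = r`.
open Finset in
theorem eq_zero_of_sum_erase_eq_zero {α K : Type*} [Fintype α] [DecidableEq α] [Field K]
    [CharZero K] (f : Finset α → K) {r : ℕ} (hr : 2 * r + 1 ≤ Fintype.card α)
    (hf : ∀ A : Finset α, A.card = r + 1 → ∑ a ∈ A, f (A.erase a) = 0)
    {B : Finset α} (hB : B.card = r) : f B = 0 := by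
  have key : ∀ T : Finset α, T.card ≤ r →
      ∑ B ∈ powersetCard r univ, f B * (if T ⊆ B then 1 else 0) = 0 := by
    intro T
    induction T using Finset.strongInduction with
    | H T ih =>
      intro hT
      have h0 := sum_card_succ_superset_sum_erase f r T
      rw [sum_eq_zero fun A hA => hf A (mem_powersetCard.1 (mem_filter.1 hA).1).2] at h0
      have h1 : ∀ B ∈ powersetCard r (univ : Finset α),
          (∑ a ∈ Bᶜ, if T.erase a ⊆ B then f B else 0) =
            ((Fintype.card α : K) - r - T.card) * (f B * (if T ⊆ B then 1 else 0)) +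
              ∑ t ∈ T, f B * (if T.erase t ⊆ B then (1 : K) else 0) := by
        intro B hB
        have h2 := congrArg (f B * ·) (sum_compl_erase_subset (K := K) B T)
        simp only [mul_add, mul_sum, (mem_powersetCard.1 hB).2] at h2
        rw [mul_left_comm, ← h2]
        simp
      rw [sum_congr rfl h1, sum_add_distrib, ← mul_sum, sum_comm,
        sum_eq_zero (s := T) fun t ht => ih _ (erase_ssubset ht)
          ((card_le_card (erase_subset _ _)).trans hT), add_zero] at h0
      refine (mul_eq_zero.1 h0.symm).resolve_left fun h => ?_
      have : (Fintype.card α : K) = ((r + T.card : ℕ) : K) := by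
        push_cast
        linear_combination h
      have := Nat.cast_injective this
      omega
  have h := key B hB.le
  rwa [sum_eq_single_of_mem B (by simp [hB]), if_pos subset_rfl, mul_one] at h
  intro A hA hAB
  rw [if_neg, mul_zero]
  intro h
  exact hAB (eq_of_subset_of_card_le h (by rw [hB, (mem_powersetCard.1 hA).2])).symm

open Finset in
theorem sum_sum_powersetCard_erase {α K : Type*} [DecidableEq α] [Field K]
    (c : Finset α → K) {j : ℕ} {A : Finset α} (hj : j ≤ A.card) :
    ∑ a ∈ A, ∑ T ∈ powersetCard j (A.erase a), c T =
      (A.card - j : K) * ∑ T ∈ powersetCard j A, c T := by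
  rw [sum_comm' (t' := powersetCard j A) (s' := fun T => A \ T), mul_sum]
  · refine sum_congr rfl fun T hT => ?_
    rw [mem_powersetCard] at hT
    rw [sum_const, card_sdiff_of_subset hT.1, nsmul_eq_mul, hT.2, Nat.cast_sub hj]
  · intro a T
    simp only [mem_powersetCard, mem_sdiff, subset_erase]
    tauto

-- Descent on `k`: the sums over `k`-sets satisfy the hypothesis of the preceding injectivity lemma,
-- so they vanish once the sums over `(k + 1)`-sets do.
open Finset in
theorem eq_zero_of_sum_powersetCard_eq_zero {α K : Type*} [Fintype α] [DecidableEq α] [Field K]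
    [CharZero K] (c : Finset α → K) {j k : ℕ} (hjk : j ≤ k) (hk : 2 * k ≤ Fintype.card α + 1)
    (hc : ∀ A : Finset α, A.card = k → ∑ T ∈ powersetCard j A, c T = 0)
    {T : Finset α} (hT : T.card = j) : c T = 0 := by
  induction k, hjk using Nat.le_induction with
  | base => simpa [← hT] using hc T hT
  | succ k hjk ih =>
    refine ih (by omega) fun B hB =>
      eq_zero_of_sum_erase_eq_zero (fun A => ∑ T ∈ powersetCard j A, c T) (r := k) (by omega)
        (fun A hA => ?_) hB
    rw [sum_sum_powersetCard_erase c (by omega), hc A hA, mul_zero]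

/-! ### The flag of superset spans -/

/-- The function on the `k`-element subsets of `Fin N` that indicates which of them contain `T`. -/
def supersetIndicator (K : Type*) [Field K] (N k : ℕ) (T : Finset (Fin N)) :
    {A : Finset (Fin N) // A.card = k} → K :=
  fun A => if T ⊆ A.1 then 1 else 0

/-- The span of the indicators of the supersets of `T`, for `T` with `j - 1` elements; it is trivial
for `j = 0`. -/
def supersetSpan (K : Type*) [Field K] (N k j : ℕ) :
    Submodule K ({A : Finset (Fin N) // A.card = k} → K) :=
  Submodule.span K (Set.range fun T : {T : Finset (Fin N) // T.card + 1 = j} =>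
    supersetIndicator K N k T.1)

theorem supersetIndicator_mem_supersetSpan (K : Type*) [Field K] {N k j : ℕ} {T : Finset (Fin N)}
    (hT : T.card + 1 = j) : supersetIndicator K N k T ∈ supersetSpan K N k j :=
  Submodule.subset_span ⟨⟨T, hT⟩, rfl⟩

theorem supersetSpan_zero (K : Type*) [Field K] (N k : ℕ) : supersetSpan K N k 0 = ⊥ := by
  rw [supersetSpan, Submodule.span_eq_bot]
  rintro _ ⟨⟨T, hT⟩, rfl⟩
  omega

open Finset in
theorem linearIndependent_supersetIndicator (K : Type*) [Field K] [CharZero K] {N k j : ℕ}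
    (hj : j ≤ k + 1) (hk : 2 * k ≤ N + 1) :
    LinearIndependent K fun T : {T : Finset (Fin N) // T.card + 1 = j} =>
      supersetIndicator K N k T.1 := by
  rw [Fintype.linearIndependent_iff]
  intro g hg T
  let c : Finset (Fin N) → K := fun T => if h : T.card + 1 = j then g ⟨T, h⟩ else 0
  have hc : ∀ T, g T = c T.1 := fun T => by simp [c, T.2]
  rw [hc]
  have hT := T.2
  refine eq_zero_of_sum_powersetCard_eq_zero c (j := j - 1) (k := k) (by omega) (by simpa using hk)
    (fun A hA => ?_) (by omega)
  have h := congrFun hg ⟨A, hA⟩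
  simp only [Finset.sum_apply, Pi.smul_apply, supersetIndicator, smul_eq_mul, mul_ite, mul_one, mul_zero,
    Pi.zero_apply, hc] at h
  rw [← h, ← sum_filter]
  refine (sum_bij (fun T _ => T.1) ?_ ?_ ?_ ?_).symm
  · rintro ⟨T, hT⟩ h
    simp only [mem_filter, mem_univ, true_and] at h
    exact mem_powersetCard.2 ⟨h, by simp only; omega⟩
  · intro _ _ _ _ h
    exact Subtype.ext h
  · intro T hT
    rw [mem_powersetCard] at hT
    exact ⟨⟨T, by omega⟩, by simpa using hT.1, rfl⟩
  · intros
    rfl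

/-- The form `N + 1 - j` of the lower index, rather than `j - 1`, gives the correct value `0` at `j
= 0`. -/
theorem finrank_supersetSpan (K : Type*) [Field K] [CharZero K] {N k j : ℕ}
    (hj : j ≤ k + 1) (hk : 2 * k ≤ N) :
    Module.finrank K (supersetSpan K N k j) = N.choose (N + 1 - j) := by
  rw [supersetSpan, finrank_span_eq_card (linearIndependent_supersetIndicator K hj (by omega))]
  rcases j with _ | j
  · have : IsEmpty {T : Finset (Fin N) // T.card + 1 = 0} := ⟨fun T => by have := T.2; omega⟩
    simp
  · simp only [Nat.add_right_cancel_iff, Fintype.card_finset_len, Fintype.card_fin]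
    rw [Nat.add_sub_add_right, Nat.choose_symm (by omega)]

-- Each `k`-set `A ⊇ T` contains `k - |T|` of the sets `insert a T` with `a ∉ T`, and `k - |T|` is
-- invertible.
open Finset in
theorem supersetSpan_le_succ (K : Type*) [Field K] [CharZero K] {N k j : ℕ} (hj : j ≤ k) :
    supersetSpan K N k j ≤ supersetSpan K N k (j + 1) := by
  refine Submodule.span_le.2 ?_
  rintro _ ⟨⟨T, hT⟩, rfl⟩
  have h : ((k : K) - T.card) • supersetIndicator K N k T =
      ∑ a ∈ Tᶜ, supersetIndicator K N k (insert a T) := by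
    ext A
    simp only [Finset.sum_apply, Pi.smul_apply, supersetIndicator, smul_eq_mul, insert_subset_iff]
    by_cases hA : T ⊆ A.1
    · simp only [hA, and_true, if_true, mul_one, sum_boole]
      have h2 : {a ∈ Tᶜ | a ∈ A.1} = A.1 \ T := by
        ext; simp [and_comm]
      rw [h2, card_sdiff_of_subset hA, A.2, Nat.cast_sub (by omega)]
    · simp [hA]
  have hne : (k : K) - T.card ≠ 0 := by
    rw [sub_ne_zero, Ne, Nat.cast_inj]
    omega
  rw [SetLike.mem_coe, ← Submodule.smul_mem_iff _ hne]
  simp only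
  rw [h]
  refine Submodule.sum_mem _ fun a ha => supersetIndicator_mem_supersetSpan K ?_
  rw [card_insert_of_notMem (mem_compl.1 ha), hT]

theorem supersetSpan_mono (K : Type*) [Field K] [CharZero K] {N k i j : ℕ} (hij : i ≤ j)
    (hj : j ≤ k + 1) : supersetSpan K N k i ≤ supersetSpan K N k j := by
  induction j, hij using Nat.le_induction with
  | base => exact le_rfl
  | succ j hij ih => exact (ih (by omega)).trans (supersetSpan_le_succ K (by omega))

theorem supersetSpan_eq_top (K : Type*) [Field K] (N k : ℕ) :
    supersetSpan K N k (k + 1) = ⊤ := by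
  rw [eq_top_iff]
  intro f _
  have h : f = ∑ A, f A • supersetIndicator K N k A.1 := by
    ext B
    simp only [Finset.sum_apply, Pi.smul_apply, supersetIndicator, smul_eq_mul]
    rw [Finset.sum_eq_single B]
    · simp
    · intro A _ hAB
      rw [if_neg, mul_zero]
      intro h
      exact hAB (Subtype.ext (Finset.eq_of_subset_of_card_le h (by rw [A.2, B.2])))
    · simp
  rw [h]
  exact Submodule.sum_mem _ fun A _ => Submodule.smul_mem _ _
    (supersetIndicator_mem_supersetSpan K (by rw [A.2]))

/-! ### Action of the adjacency operator on the flag -/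

open Finset in
/-- The sets counted are the complements of `insert a A`, for `a` outside `A ∪ T`. -/
theorem card_filter_disjoint_superset {N k : ℕ} (hN : N = 2 * k + 1) {A T : Finset (Fin N)}
    (hA : A.card = k) (hAT : Disjoint A T) :
    #{B : {B : Finset (Fin N) // B.card = k} | Disjoint A B.1 ∧ T ⊆ B.1} = k + 1 - T.card := by
  have h : #((A ∪ T)ᶜ) = k + 1 - T.card := by
    rw [card_compl, card_union_of_disjoint hAT, Fintype.card_fin]
    omega
  rw [← h]
  symm
  refine card_bij (fun a ha => ⟨(insert a A)ᶜ, ?_⟩) ?_ ?_ ?_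
  · simp only [mem_compl, mem_union, not_or] at ha
    rw [card_compl, card_insert_of_notMem ha.1, Fintype.card_fin]
    omega
  · intro a ha
    simp only [mem_compl, mem_union, not_or] at ha
    simp only [mem_filter, mem_univ, true_and]
    refine ⟨disjoint_compl_right.mono_left (subset_insert _ _), ?_⟩
    rw [subset_compl_iff_disjoint_right, disjoint_insert_right]
    exact ⟨ha.2, hAT.symm⟩
  · intro a ha b hb hab
    simp only [mem_compl, mem_union, not_or] at ha hb
    simp only [Subtype.mk.injEq, compl_inj_iff] at hab
    have : a ∈ insert b A := hab ▸ mem_insert_self a A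
    exact (mem_insert.1 this).resolve_right ha.1
  · rintro ⟨B, hB⟩ h
    simp only [mem_filter, mem_univ, true_and] at h
    have h1 : #((A ∪ B)ᶜ) = 1 := by
      rw [card_compl, card_union_of_disjoint h.1, Fintype.card_fin]
      omega
    obtain ⟨a, ha⟩ := card_eq_one.1 h1
    have ha' : a ∉ A ∧ a ∉ B := by
      have : a ∈ (A ∪ B)ᶜ := ha ▸ mem_singleton_self a
      simpa using this
    refine ⟨a, ?_, ?_⟩
    · simp only [mem_compl, mem_union, not_or]
      exact ⟨ha'.1, fun haT => ha'.2 (h.2 haT)⟩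
    · apply Subtype.ext
      ext x
      have hx : x ∈ (A ∪ B)ᶜ ↔ x = a := by rw [ha, mem_singleton]
      simp only [mem_compl, mem_union, mem_insert] at hx ⊢
      have : x ∈ A → x ∉ B := fun hxA => disjoint_left.1 h.1 hxA
      by_cases hxa : x = a
      · subst hxa
        simp [ha'.2]
      · tauto

open Finset in
theorem sum_powerset_neg_one_pow_card_supersetIndicator {K : Type*} [Field K] {N k : ℕ}
    (T : Finset (Fin N)) (A : {A : Finset (Fin N) // A.card = k}) :
    ∑ S ∈ T.powerset, (-1) ^ S.card * supersetIndicator K N k S A =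
      if Disjoint A.1 T then 1 else 0 := by
  simp only [supersetIndicator, mul_ite, mul_one, mul_zero, ← sum_filter]
  have h : {S ∈ T.powerset | S ⊆ A.1} = (A.1 ∩ T).powerset := by
    ext S
    rw [mem_filter, mem_powerset, mem_powerset, subset_inter_iff, and_comm]
  have h2 := congrArg (Int.cast : ℤ → K) (sum_powerset_neg_one_pow_card (x := A.1 ∩ T))
  push_cast at h2
  rw [h, h2]
  simp [disjoint_iff_inter_eq_empty]

open Finset in
theorem kneserGraph_adjMatrix_mulVec_supersetIndicator {K : Type*} [Field K] {N k : ℕ}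
    (hN : N = 2 * k + 1) (hk : 1 ≤ k) {T : Finset (Fin N)} (hT : T.card ≤ k) :
    Matrix.toLin' ((kneserGraph N k).adjMatrix K) (supersetIndicator K N k T) =
      (k + 1 - T.card : K) • ∑ S ∈ T.powerset, (-1 : K) ^ S.card • supersetIndicator K N k S := by
  ext A
  rw [Matrix.toLin'_apply, SimpleGraph.adjMatrix_mulVec_apply]
  simp only [Pi.smul_apply, Finset.sum_apply, smul_eq_mul,
    sum_powerset_neg_one_pow_card_supersetIndicator]
  simp only [supersetIndicator, sum_boole]
  have h : {B ∈ (kneserGraph N k).neighborFinset A | T ⊆ B.1} =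
      ({B : {B : Finset (Fin N) // B.card = k} | Disjoint A.1 B.1 ∧ T ⊆ B.1} : Finset _) := by
    ext B
    simp only [mem_filter, SimpleGraph.mem_neighborFinset, mem_univ, true_and, and_congr_left_iff]
    refine fun _ => ⟨And.right, fun hd => ⟨?_, hd⟩⟩
    -- A set disjoint from itself is empty, which `1 ≤ k` excludes.
    rintro rfl
    have := A.2
    rw [(disjoint_self_iff_empty _).1 hd, card_empty] at this
    omega
  rw [h]
  by_cases hAT : Disjoint A.1 T
  · rw [card_filter_disjoint_superset hN A.2 hAT, if_pos hAT, Nat.cast_sub (by omega)]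
    simp
  · rw [if_neg hAT, mul_zero, filter_eq_empty_iff.2, card_empty, Nat.cast_zero]
    rintro B - ⟨h1, h2⟩
    exact hAT (h1.mono_right h2)

open Finset in
theorem kneserGraph_adjMatrix_sub_smul_mem_supersetSpan {K : Type*} [Field K] [CharZero K]
    {N k : ℕ} (hN : N = 2 * k + 1) (hk : 1 ≤ k) {j : ℕ} (hj : j ≤ k)
    {v : {A : Finset (Fin N) // A.card = k} → K} (hv : v ∈ supersetSpan K N k (j + 1)) :
    Matrix.toLin' ((kneserGraph N k).adjMatrix K) v - ((-1) ^ j * (k + 1 - j : K)) • v ∈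
      supersetSpan K N k j := by
  induction hv using Submodule.span_induction with
  | zero => simp
  | add x y _ _ hx hy =>
    rw [map_add, smul_add, add_sub_add_comm]
    exact add_mem hx hy
  | smul a x _ hx =>
    rw [map_smul, smul_comm, ← smul_sub]
    exact Submodule.smul_mem _ _ hx
  | mem x hx =>
    obtain ⟨⟨T, hT⟩, rfl⟩ := hx
    obtain rfl : T.card = j := by omega
    simp only
    -- The term `S = T` is the diagonal part; proper subsets lie lower in the flag.
    rw [kneserGraph_adjMatrix_mulVec_supersetIndicator hN hk hj,
      ← sum_erase_add _ _ (mem_powerset_self T), smul_add, smul_smul, mul_comm, add_sub_cancel_right]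
    refine Submodule.smul_mem _ _ (Submodule.sum_mem _ fun S hS => Submodule.smul_mem _ _ ?_)
    rw [mem_erase, mem_powerset] at hS
    have := card_lt_card (hS.2.ssubset_of_ne hS.1)
    exact supersetSpan_mono K (by omega) (by omega)
      (supersetIndicator_mem_supersetSpan K (j := S.card + 1) rfl)

/-! ### Operators triangular along a flag -/

section TriangularEigenspace

variable {K V : Type*} [Field K] [AddCommGroup V] [Module K V] {f : Module.End K V}
  {W : ℕ → Submodule K V} {c : ℕ → K} {n : ℕ}

theorem Module.End.map_mem_of_sub_smul_mem (hmono : ∀ j < n, W j ≤ W (j + 1)) (h0 : W 0 = ⊥)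
    (hf : ∀ j < n, ∀ v ∈ W (j + 1), f v - c j • v ∈ W j) {j : ℕ} (hj : j ≤ n) {v : V}
    (hv : v ∈ W j) : f v ∈ W j := by
  rcases j with _ | j
  · rw [h0, Submodule.mem_bot] at hv ⊢
    rw [hv, map_zero]
  · rw [← sub_add_cancel (f v) (c j • v)]
    exact add_mem (hmono j hj (hf j hj v hv)) (Submodule.smul_mem _ _ hv)

/-- Modulo `W j`, `(f - μ) ^ m` multiplies `v` by `(c j - μ) ^ m`, which is nonzero. -/
theorem Module.End.mem_of_mem_maxGenEigenspace_of_mem_succ (hmono : ∀ j < n, W j ≤ W (j + 1))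
    (h0 : W 0 = ⊥) (hf : ∀ j < n, ∀ v ∈ W (j + 1), f v - c j • v ∈ W j) {j : ℕ} (hj : j < n)
    {μ : K} (hμ : c j ≠ μ) {v : V} (hv : v ∈ W (j + 1)) (hvμ : v ∈ f.maxGenEigenspace μ) :
    v ∈ W j := by
  obtain ⟨m, hm⟩ := (Module.End.mem_maxGenEigenspace f μ v).1 hvμ
  have key : ∀ m : ℕ, ((f - μ • (1 : Module.End K V)) ^ m) v - (c j - μ) ^ m • v ∈ W j := by
    intro m
    induction m with
    | zero => simp
    | succ m ih =>
      set u := ((f - μ • (1 : Module.End K V)) ^ m) v - (c j - μ) ^ m • v with hu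
      have hu' : ((f - μ • (1 : Module.End K V)) ^ m) v = u + (c j - μ) ^ m • v := by
        rw [hu, sub_add_cancel]
      have h1 : ((f - μ • (1 : Module.End K V)) ^ (m + 1)) v - (c j - μ) ^ (m + 1) • v =
          (f u - μ • u) + (c j - μ) ^ m • (f v - c j • v) := by
        rw [pow_succ' (f - μ • (1 : Module.End K V)), Module.End.mul_apply, hu']
        simp only [LinearMap.sub_apply, LinearMap.smul_apply, Module.End.one_apply, map_add,
          map_smul]
        module
      rw [h1]
      exact add_mem (sub_mem (Module.End.map_mem_of_sub_smul_mem hmono h0 hf hj.le ih)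
        (Submodule.smul_mem _ _ ih)) (Submodule.smul_mem _ _ (hf j hj v hv))
  have h := key m
  rw [hm, zero_sub, neg_mem_iff] at h
  exact (Submodule.smul_mem_iff _ (pow_ne_zero m (sub_ne_zero.2 hμ))).1 h

theorem Module.End.mem_of_mem_maxGenEigenspace (hmono : ∀ j < n, W j ≤ W (j + 1))
    (h0 : W 0 = ⊥) (hf : ∀ j < n, ∀ v ∈ W (j + 1), f v - c j • v ∈ W j) {μ : K} {a b : ℕ}
    (hab : a ≤ b) (hb : b ≤ n) (hμ : ∀ j, a ≤ j → j < b → c j ≠ μ) {v : V} (hv : v ∈ W b)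
    (hvμ : v ∈ f.maxGenEigenspace μ) : v ∈ W a := by
  induction b, hab using Nat.le_induction with
  | base => exact hv
  | succ b hab ih =>
    exact ih (by omega) (fun j h1 h2 => hμ j h1 (by omega))
      (Module.End.mem_of_mem_maxGenEigenspace_of_mem_succ hmono h0 hf hb
        (hμ b hab (by omega)) hv hvμ)

theorem Module.End.exists_eq_of_hasEigenvalue (hmono : ∀ j < n, W j ≤ W (j + 1))
    (h0 : W 0 = ⊥) (hn : W n = ⊤) (hf : ∀ j < n, ∀ v ∈ W (j + 1), f v - c j • v ∈ W j) {μ : K}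
    (hμ : f.HasEigenvalue μ) : ∃ j < n, c j = μ := by
  by_contra! h
  obtain ⟨v, hv⟩ := hμ.exists_hasEigenvector
  have := Module.End.mem_of_mem_maxGenEigenspace hmono h0 hf (Nat.zero_le n) le_rfl
    (fun j _ hj => h j hj) (hn ▸ Submodule.mem_top)
    (Module.End.eigenspace_le_maxGenEigenspace hv.1)
  rw [h0, Submodule.mem_bot] at this
  exact hv.2 this

theorem Module.End.maxGenEigenspace_inf_eq_bot (hmono : ∀ j < n, W j ≤ W (j + 1))
    (h0 : W 0 = ⊥) (hf : ∀ j < n, ∀ v ∈ W (j + 1), f v - c j • v ∈ W j)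
    (hc : Set.InjOn c (Set.Iio n)) {j : ℕ} (hj : j < n) :
    f.maxGenEigenspace (c j) ⊓ W j = ⊥ := by
  rw [eq_bot_iff, ← h0]
  rintro v ⟨hv, hvW⟩
  exact Module.End.mem_of_mem_maxGenEigenspace hmono h0 hf (Nat.zero_le j) hj.le
    (fun i _ hi h => hi.ne (hc (hi.trans hj) hj h)) hvW hv

theorem Module.End.maxGenEigenspace_le (hmono : ∀ j < n, W j ≤ W (j + 1))
    (h0 : W 0 = ⊥) (hn : W n = ⊤) (hf : ∀ j < n, ∀ v ∈ W (j + 1), f v - c j • v ∈ W j)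
    (hc : Set.InjOn c (Set.Iio n)) {j : ℕ} (hj : j < n) :
    f.maxGenEigenspace (c j) ≤ W (j + 1) := fun _ hv =>
  Module.End.mem_of_mem_maxGenEigenspace hmono h0 hf hj le_rfl
    (fun _ hi hin h => (Nat.lt_of_succ_le hi).ne (hc hj hin h.symm)) (hn ▸ Submodule.mem_top) hv

variable [FiniteDimensional K V]

/-- `f - c j` is injective on `W j`, hence onto it by finite dimension. So `(f - c j) v = (f - c j)
w` for some `w ∈ W j`, and `v - w` lies in the eigenspace. -/
theorem Module.End.le_eigenspace_sup (hmono : ∀ j < n, W j ≤ W (j + 1))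
    (h0 : W 0 = ⊥) (hf : ∀ j < n, ∀ v ∈ W (j + 1), f v - c j • v ∈ W j)
    (hc : Set.InjOn c (Set.Iio n)) {j : ℕ} (hj : j < n) :
    W (j + 1) ≤ f.eigenspace (c j) ⊔ W j := by
  intro v hv
  have hmap : ∀ w ∈ W j, (f - c j • (1 : Module.End K V)) w ∈ W j := fun w hw =>
    sub_mem (Module.End.map_mem_of_sub_smul_mem hmono h0 hf hj.le hw) (Submodule.smul_mem _ _ hw)
  let g : W j →ₗ[K] W j := (f - c j • (1 : Module.End K V)).restrict hmap
  have hg : Function.Injective g := by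
    rw [injective_iff_map_eq_zero]
    intro w hw
    have h1 : (w : V) ∈ f.maxGenEigenspace (c j) ⊓ W j := by
      refine ⟨Module.End.eigenspace_le_maxGenEigenspace
        (Module.End.mem_eigenspace_iff.2 (sub_eq_zero.1 ?_)), w.2⟩
      exact congrArg Subtype.val hw
    rw [Module.End.maxGenEigenspace_inf_eq_bot hmono h0 hf hc hj, Submodule.mem_bot] at h1
    exact Subtype.ext h1
  obtain ⟨w, hw⟩ := LinearMap.injective_iff_surjective.1 hg ⟨_, hf j hj v hv⟩
  have hw' : f w - c j • (w : V) = f v - c j • v := congrArg Subtype.val hw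
  rw [← sub_add_cancel v (w : V)]
  refine Submodule.add_mem_sup (Module.End.mem_eigenspace_iff.2 ?_) w.2
  rw [map_sub, smul_sub, sub_eq_sub_iff_sub_eq_sub]
  exact hw'.symm

/-- Both multiplicities of an eigenvalue of an operator that is triangular with respect to a flag
and acts on the successive quotients by distinct scalars. -/
theorem Module.End.finrank_eigenspace_add_finrank (hmono : ∀ j < n, W j ≤ W (j + 1))
    (h0 : W 0 = ⊥) (hn : W n = ⊤) (hf : ∀ j < n, ∀ v ∈ W (j + 1), f v - c j • v ∈ W j)
    (hc : Set.InjOn c (Set.Iio n)) {j : ℕ} (hj : j < n) :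
    Module.finrank K (f.eigenspace (c j)) + Module.finrank K (W j) =
        Module.finrank K (W (j + 1)) ∧
      Module.finrank K (f.maxGenEigenspace (c j)) + Module.finrank K (W j) =
        Module.finrank K (W (j + 1)) := by
  have hle := Module.End.eigenspace_le_maxGenEigenspace (f := f) (μ := c j)
  have hinf := Module.End.maxGenEigenspace_inf_eq_bot hmono h0 hf hc hj
  have hsup := Module.End.le_eigenspace_sup hmono h0 hf hc hj
  have hgen := Module.End.maxGenEigenspace_le hmono h0 hn hf hc hj
  constructor
  · rw [← Submodule.finrank_sup_add_finrank_inf_eq,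
      eq_bot_iff.2 ((inf_le_inf_right _ hle).trans hinf.le), finrank_bot, add_zero,
      le_antisymm (sup_le (hle.trans hgen) (hmono j hj)) hsup]
  · rw [← Submodule.finrank_sup_add_finrank_inf_eq, hinf, finrank_bot, add_zero,
      le_antisymm (sup_le hgen (hmono j hj)) (hsup.trans (sup_le_sup_right hle _))]

end TriangularEigenspace

/-! ### The Catalan triangle as a difference of binomials -/

/-- Pascal's rule applied twice gives the `1, 2, 1` recurrence. At `k = 0` the symmetry `hs` makes
the missing term of index `-1` vanish. -/
theorem catalanTriangle_add_choose (m k : ℕ) :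
    catalanTriangle m k + (2 * m + 1).choose (m + 2 + k) = (2 * m + 1).choose (m + 1 + k) := by
  induction m generalizing k with
  | zero =>
    rcases k with _ | k
    · simp [catalanTriangle]
    · rw [Nat.choose_eq_zero_of_lt (by omega), Nat.choose_eq_zero_of_lt (by omega),
        catalanTriangle]
  | succ m ih =>
    have p : ∀ i, (2 * (m + 1) + 1).choose (i + 2) = (2 * m + 1).choose i +
        2 * (2 * m + 1).choose (i + 1) + (2 * m + 1).choose (i + 2) := by
      intro i
      rw [show 2 * (m + 1) + 1 = 2 * m + 1 + 1 + 1 by ring, Nat.choose_succ_succ,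
        Nat.choose_succ_succ, Nat.choose_succ_succ (2 * m + 1) (i + 1)]
      ring
    rcases k with _ | k
    · have h0 := ih 0
      have h1 := ih 1
      have hs : (2 * m + 1).choose m = (2 * m + 1).choose (m + 1) :=
        Nat.choose_symm_of_eq_add (by ring)
      rw [catalanTriangle, show m + 1 + 2 + 0 = m + 1 + 2 by ring, p,
        show m + 1 + 1 + 0 = m + 2 by ring, p]
      simp only [add_zero, show m + 2 + 1 = m + 3 by ring, show m + 1 + 1 = m + 2 by ring] at *
      omega
    · have h0 := ih k
      have h1 := ih (k + 1)
      have h2 := ih (k + 2)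
      rw [catalanTriangle, show m + 1 + 2 + (k + 1) = m + k + 2 + 2 by ring, p,
        show m + 1 + 1 + (k + 1) = m + k + 1 + 2 by ring, p]
      simp only [show m + 2 + k = m + k + 2 by ring, show m + 1 + k = m + k + 1 by ring,
        show m + 2 + (k + 1) = m + k + 3 by ring, show m + 1 + (k + 1) = m + k + 2 by ring,
        show m + 2 + (k + 2) = m + k + 4 by ring, show m + 1 + (k + 2) = m + k + 3 by ring,
        show m + k + 2 + 1 = m + k + 3 by ring, show m + k + 2 + 2 = m + k + 4 by ring,
        show m + k + 1 + 1 = m + k + 2 by ring] at *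
      omega

theorem catalanTriangle_pos {m k : ℕ} (h : k ≤ m) : 0 < catalanTriangle m k := by
  induction m generalizing k with
  | zero =>
    obtain rfl := Nat.le_zero.1 h
    simp [catalanTriangle]
  | succ m ih =>
    rcases k with _ | k <;> rw [catalanTriangle]
    · have := ih (Nat.zero_le m)
      omega
    · have := ih (Nat.le_of_succ_le_succ h)
      omega

theorem catalanTriangle_zero_right (m : ℕ) : catalanTriangle m 0 = catalan (m + 1) := by
  have h := catalanTriangle_add_choose m 0
  simp only [add_zero] at h
  have h1 := Nat.choose_succ_right_eq (2 * m + 1) (m + 1)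
  have h2 := succ_mul_catalan_eq_centralBinom (m + 1)
  have hs : (2 * m + 1).choose m = (2 * m + 1).choose (m + 1) :=
    Nat.choose_symm_of_eq_add (by ring)
  rw [Nat.centralBinom_eq_two_mul_choose, show 2 * (m + 1) = 2 * m + 1 + 1 by ring,
    Nat.choose_succ_succ, hs] at h2
  rw [show 2 * m + 1 - (m + 1) = m by omega] at h1
  apply Nat.eq_of_mul_eq_mul_left (show 0 < m + 1 + 1 by omega)
  rw [h2]
  nlinarith

/-! ### Spectrum of the odd graph -/

/-- The eigenvalues of the odd graph `O_n` on the successive quotients of the flag of spans. -/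
theorem neg_one_pow_mul_sub_eq {K : Type*} [Field K] {n i : ℕ} (hi : i ∈ Finset.Icc 1 n) :
    (-1) ^ (n - i) * (((n - 1 : ℕ) : K) + 1 - (n - i : ℕ)) = (-1) ^ (n + i) * (i : K) := by
  rw [Finset.mem_Icc] at hi
  rw [show n + i = n - i + 2 * i by omega, pow_add, pow_mul, neg_one_sq, one_pow, mul_one,
    Nat.cast_sub hi.2, Nat.cast_sub (hi.1.trans hi.2)]
  push_cast
  ring

/-- Squaring removes the sign. -/
theorem injOn_neg_one_pow_mul {K : Type*} [Field K] [CharZero K] (n : ℕ) :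
    Set.InjOn (fun i : ℕ => (-1) ^ (n + i) * (i : K)) (Set.Icc 1 n) := by
  intro i _ j _ hij
  have h := congrArg (· ^ 2) hij
  simp only [mul_pow, ← pow_mul, mul_comm _ 2] at h
  simp only [pow_mul, neg_one_sq, one_pow, one_mul] at h
  norm_cast at h
  exact Nat.pow_left_injective two_ne_zero h

theorem oddAdjacency_multiplicities (K : Type*) [Field K] [CharZero K] {n i : ℕ} (hn : 2 ≤ n)
    (hi : i ∈ Finset.Icc 1 n) :
    Module.finrank K ((oddAdjacency K n).eigenspace ((-1) ^ (n + i) * (i : K))) =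
        catalanTriangle (n - 1) (i - 1) ∧
      ((oddGraph n).adjMatrix K).charpoly.rootMultiplicity ((-1) ^ (n + i) * (i : K)) =
        catalanTriangle (n - 1) (i - 1) := by
  have hi' := Finset.mem_Icc.1 hi
  have hc : Set.InjOn (fun j : ℕ => (-1) ^ j * (((n - 1 : ℕ) : K) + 1 - j)) (Set.Iio n) := by
    intro a ha b hb hab
    rw [Set.mem_Iio] at ha hb
    have h := injOn_neg_one_pow_mul (K := K) n
      (show n - a ∈ Set.Icc 1 n from ⟨by omega, by omega⟩)
      (show n - b ∈ Set.Icc 1 n from ⟨by omega, by omega⟩) (by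
        simp only
        rw [← neg_one_pow_mul_sub_eq (Finset.mem_Icc.2 ⟨by omega, by omega⟩),
          ← neg_one_pow_mul_sub_eq (Finset.mem_Icc.2 ⟨by omega, by omega⟩),
          Nat.sub_sub_self ha.le, Nat.sub_sub_self hb.le]
        exact hab)
    omega
  have key := Module.End.finrank_eigenspace_add_finrank (n := n) (j := n - i)
    (f := oddAdjacency K n) (W := supersetSpan K (2 * n - 1) (n - 1))
    (fun j hj => supersetSpan_le_succ K (by omega)) (supersetSpan_zero K _ _)
    ((congrArg _ (by omega)).trans (supersetSpan_eq_top K (2 * n - 1) (n - 1)))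
    (fun j hj v hv => kneserGraph_adjMatrix_sub_smul_mem_supersetSpan (by omega) (by omega)
      (by omega) hv) hc (by omega)
  rw [neg_one_pow_mul_sub_eq hi, finrank_supersetSpan K (by omega) (by omega),
    finrank_supersetSpan K (by omega) (by omega), LinearMap.finrank_maxGenEigenspace_eq,
    Matrix.charpoly_toLin'] at key
  -- With `j = n - i` and `N = 2n - 1`, the two binomials are the dimensions of `W_j` and `W_{j+1}`.
  have h := catalanTriangle_add_choose (n - 1) (i - 1)
  rw [show 2 * (n - 1) + 1 = 2 * n - 1 by omega,
    show n - 1 + 2 + (i - 1) = 2 * n - 1 + 1 - (n - i) by omega,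
    show n - 1 + 1 + (i - 1) = 2 * n - 1 + 1 - (n - i + 1) by omega] at h
  omega

theorem exists_of_oddAdjacency_hasEigenvalue {K : Type*} [Field K] [CharZero K] {n : ℕ}
    (hn : 2 ≤ n) {μ : K} (hμ : (oddAdjacency K n).HasEigenvalue μ) :
    ∃ i ∈ Finset.Icc 1 n, μ = (-1) ^ (n + i) * (i : K) := by
  obtain ⟨j, hj, rfl⟩ := Module.End.exists_eq_of_hasEigenvalue (n := n)
    (c := fun j : ℕ => (-1) ^ j * (((n - 1 : ℕ) : K) + 1 - j))
    (W := supersetSpan K (2 * n - 1) (n - 1))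
    (fun j hj => supersetSpan_le_succ K (by omega)) (supersetSpan_zero K _ _)
    ((congrArg _ (by omega)).trans (supersetSpan_eq_top K (2 * n - 1) (n - 1)))
    (fun j hj v hv => kneserGraph_adjMatrix_sub_smul_mem_supersetSpan (by omega) (by omega)
      (by omega) hv) hμ
  have hi : n - j ∈ Finset.Icc 1 n := Finset.mem_Icc.2 ⟨by omega, by omega⟩
  refine ⟨n - j, hi, ?_⟩
  rw [← neg_one_pow_mul_sub_eq hi, Nat.sub_sub_self hj.le]

theorem mainTheorem2 (K : Type*) [Field K] [CharZero K] (n : ℕ) (hn : 2 ≤ n) :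
    -- the eigenvalues are exactly the pairwise distinct numbers `(-1) ^ (n + i) * i`, `1 ≤ i ≤ n`
    (∀ μ : K, (oddAdjacency K n).HasEigenvalue μ ↔
      ∃ i ∈ Finset.Icc 1 n, μ = (-1) ^ (n + i) * (i : K)) ∧
    Set.InjOn (fun i : ℕ => (-1) ^ (n + i) * (i : K)) (Set.Icc 1 n) ∧
    -- geometric and algebraic multiplicities
    (∀ i ∈ Finset.Icc 1 n,
      Module.finrank K ((oddAdjacency K n).eigenspace ((-1) ^ (n + i) * (i : K))) =
        catalanTriangle (n - 1) (i - 1) ∧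
      ((oddGraph n).adjMatrix K).charpoly.rootMultiplicity ((-1) ^ (n + i) * (i : K)) =
        catalanTriangle (n - 1) (i - 1)) ∧
    -- the eigenvalue `(-1) ^ (n + 1)` has multiplicity the Catalan number `C_n`
    Module.finrank K ((oddAdjacency K n).eigenspace ((-1) ^ (n + 1))) = catalan n ∧
    ((oddGraph n).adjMatrix K).charpoly.rootMultiplicity ((-1) ^ (n + 1) : K) = catalan n := by
  have h1 := oddAdjacency_multiplicities K hn (i := 1) (Finset.mem_Icc.2 ⟨le_rfl, by omega⟩)
  rw [Nat.cast_one, mul_one, Nat.sub_self, catalanTriangle_zero_right,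
    Nat.sub_add_cancel (by omega)] at h1
  refine ⟨fun μ => ⟨exists_of_oddAdjacency_hasEigenvalue hn, ?_⟩, injOn_neg_one_pow_mul n,
    fun i hi => oddAdjacency_multiplicities K hn hi, h1⟩
  -- `HasEigenvalue` unfolds to a negation: `hbot` says the eigenspace is zero, against the positive
  -- Catalan entry.
  rintro ⟨i, hi, rfl⟩ hbot
  have h := (oddAdjacency_multiplicities K hn hi).1
  rw [Module.End.eigenspace, hbot, finrank_bot] at h
  have := Finset.mem_Icc.1 hi
  exact (catalanTriangle_pos (m := n - 1) (k := i - 1) (by omega)).ne h
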